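/- **Setting.** Let $\mathcal V$ be a countably infinite set of qubit variables; for a finite $V\subseteq\mathcal V$ let $\mathcal H_V=\bigotimes_{q\in V}\mathbb C^2$. A partial density operator on $\mathcal H_V$ is a positive operator of trace at most $1$, and an effect on $\mathcal H_V$ is an operator $M$ with $0\sqsubseteq M\sqsubseteq I$, where $A\sqsubseteq B$ means that $B-A$ is positive. Write $\mathcal D(\mathcal H_V)$ and $\mathcal P(\mathcal H_V)$ for the sets of partial density operators and of effects. Let $\mathit{DProg}(V)$ be the set of completely positive trace-nonincreasing (CPTN) super-operators on $\mathcal H_V$, partially ordered by the CP order: $\mathcal E\sqsubseteq\mathcal F$ iff $\mathcal F-\mathcal E$ is completely positive. Let $\mathit{NProg}(V)$ be the set of nonempty, convex, closed subsets $\mathbb E\subseteq\mathit{DProg}(V)$ (closed in the Euclidean topology). Operators and super-operators on a subsystem are extended to larger systems by tensoring with the identity. For $W\subseteq X$ finite, $\Theta\subseteq\mathcal P(\mathcal H_W)$ and $\rho\in\mathcal D(\mathcal H_X)$ put $\mathrm{Exp}(\rho\models\Theta)=\inf_{M\in\Theta}\operatorname{tr}(M\rho)$, which is $\operatorname{tr}(\rho)$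 by convention when $\Theta=\emptyset$. For $\mathbb E\in\mathit{NProg}(V)$ put $\mathbb E(\rho)=\{\mathcal E(\rho):\mathcal E\in\mathbb E\}$. A specification is a pair $(\Theta,\Psi)$ of arbitrary subsets of $\mathcal P(\mathcal H_W)$, with $W\subseteq\mathcal V$ finite. Say that * $\mathbb E\models_{\rm tot}(\Theta,\Psi)$ if for all finite $X\supseteq V\cup W$ and all $\rho\in\mathcal D(\mathcal H_X)$, $\ \mathrm{Exp}(\rho\models\Theta)\le\inf\{\mathrm{Exp}(\sigma\models\Psi):\sigma\in\mathbb E(\rho)\}$; * $\mathbb E\models_{\rm par}(\Theta,\Psi)$ if for all such $X,\rho$, $\ \mathrm{Exp}(\rho\models\Theta)\le\inf\{\mathrm{Exp}(\sigma\models\Psi)+\operatorname{tr}(\rho)-\operatorname{tr}(\sigma):\sigma\in\mathbb E(\rho)\}$. Write $\mathbb E\le_T^s\mathbb F$ (resp. $\mathbb E\le_P^s\mathbb F$) if for every finite $W$ and every specification $(\Theta,\Psi)$ on $W$, $\mathbb E\models_{\rm tot}(\Theta,\Psi)$ implies $\mathbb F\models_{\rm tot}(\Theta,\Psi)$ (resp.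 the same with $\models_{\rm par}$). Let $\equiv_T^s$ and $\equiv_P^s$ be the kernels of these preorders (refinement in both directions). For subsets of the poset $\mathit{DProg}(V)$ let $\uparrow\!\mathbb E$, $\downarrow\!\mathbb E$ be the up- and down-closures in $\mathit{DProg}(V)$, and put $\mathbb E\le_H\mathbb F$ iff $\forall\mathcal E\in\mathbb E\,\exists\mathcal F\in\mathbb F:\mathcal E\sqsubseteq\mathcal F$ (Hoare); $\mathbb E\le_S\mathbb F$ iff $\forall\mathcal F\in\mathbb F\,\exists\mathcal E\in\mathbb E:\mathcal E\sqsubseteq\mathcal F$ (Smyth); $\mathbb E\le_{EM}\mathbb F$ iff $\mathbb E\le_H\mathbb F$ and $\mathbb E\le_S\mathbb F$ (Egli–Milner). **Theorem (Set-of-Effects Refinement Characterization).** For every finite $V\subseteq\mathcal V$ and all $\mathbb E,\mathbb F\in\mathit{NProg}(V)$: 1. $\mathbb E\le_T^s\mathbb F$ iff $\mathbb E\le_S\mathbb F$ iff $\uparrow\!\mathbb F\subseteq\,\uparrow\!\mathbb E$; 2. $\mathbb E\le_P^s\mathbb F$ iff $\mathbb F\le_H\mathbb E$ iff $\downarrow\!\mathbb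 F\subseteq\,\downarrow\!\mathbb E$; 3. $\mathbb E\le_{EM}\mathbb F$ iff both $\mathbb E\le_T^s\mathbb F$ and $\mathbb F\le_P^s\mathbb E$; 4. $\mathbb E\equiv_T^s\mathbb F$ iff $\uparrow\!\mathbb E=\,\uparrow\!\mathbb F$, and $\mathbb E\equiv_P^s\mathbb F$ iff $\downarrow\!\mathbb E=\,\downarrow\!\mathbb F$; 5. if $\mathbb E$ and $\mathbb F$ contain only trace-preserving super-operators, then $\mathbb E\le_T^s\mathbb F$ iff $\mathbb E\le_P^s\mathbb F$ iff $\mathbb F\subseteq\mathbb E$. -/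

import Mathlib

namespace QuantumRefinement

open scoped Matrix Kronecker ComplexOrder

/-! ### Quantum variables, operators and super-operators

`𝒱` is the type of quantum variables. Each of them carries a qubit `ℂ²`, so for a finite set `V` of
variables the state space `ℋ_V = ⨂_{q ∈ V} ℂ²` has the computational basis `V → Fin 2`. Linear
operators on `ℋ_V` are written as matrices in this basis. -/

/-- The computational basis of `ℋ_V`. -/
abbrev Ket {𝒱 : Type*} (V : Finset 𝒱) : Type _ := V → Fin 2

/-- `ℒ(ℋ_V)`, the linear operators on `ℋ_V`. -/
abbrev Op {𝒱 : Type*} (V : Finset 𝒱) : Type _ := Matrix (Ket V) (Ket V) ℂ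

/-- The map `ℐ_k ⊗ Φ` on operators on `ℂ^k ⊗ ℂ^n`: it applies `Φ` to every `n × n` block. -/
def ampliation {n m : Type*} (k : Type*)
    (Φ : Matrix n n ℂ →ₗ[ℂ] Matrix m m ℂ) (A : Matrix (k × n) (k × n) ℂ) :
    Matrix (k × m) (k × m) ℂ :=
  Matrix.of fun i j => Φ (Matrix.of fun a b => A (i.1, a) (j.1, b)) i.2 j.2

/-- `ampliation` is the map determined by `(ℐ ⊗ Φ)(A ⊗ B) = A ⊗ Φ(B)`. -/
theorem ampliation_kronecker {n m k : Type*} (Φ : Matrix n n ℂ →ₗ[ℂ] Matrix m m ℂ)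
    (A : Matrix k k ℂ) (B : Matrix n n ℂ) : ampliation k Φ (A ⊗ₖ B) = A ⊗ₖ Φ B := by
  ext i j
  have h : (Matrix.of fun a b => (A ⊗ₖ B) (i.1, a) (j.1, b)) = A i.1 j.1 • B := by
    ext a b; simp [Matrix.kroneckerMap_apply]
  rw [ampliation, Matrix.of_apply, h, map_smul, Matrix.smul_apply, smul_eq_mul,
    Matrix.kroneckerMap_apply]

/-- `Φ` is completely positive: `ℐ ⊗ Φ` is positive for every finite-dimensional auxiliary
space. -/
def IsCompletelyPositive {n m : Type*} (Φ : Matrix n n ℂ →ₗ[ℂ] Matrix m m ℂ) : Prop :=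
  ∀ (d : ℕ) (A : Matrix (Fin d × n) (Fin d × n) ℂ),
    A.PosSemidef → (ampliation (Fin d) Φ A).PosSemidef

/-- `tr Φ(A) ≤ tr A` for every positive `A`. -/
def IsTraceNonincreasing {n m : Type*} [Fintype n] [Fintype m]
    (Φ : Matrix n n ℂ →ₗ[ℂ] Matrix m m ℂ) : Prop :=
  ∀ A : Matrix n n ℂ, A.PosSemidef → (Φ A).trace.re ≤ A.trace.re

/-- `tr Φ(A) = tr A` for every positive `A`. -/
def IsTracePreserving {n m : Type*} [Fintype n] [Fintype m]
    (Φ : Matrix n n ℂ →ₗ[ℂ] Matrix m m ℂ) : Prop :=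
  ∀ A : Matrix n n ℂ, A.PosSemidef → (Φ A).trace = A.trace

theorem IsCompletelyPositive.zero {n m : Type*} :
    IsCompletelyPositive (0 : Matrix n n ℂ →ₗ[ℂ] Matrix m m ℂ) := by
  intro d A _
  have h : ampliation (Fin d) (0 : Matrix n n ℂ →ₗ[ℂ] Matrix m m ℂ) A = 0 := by
    ext i j; simp [ampliation]
  rw [h]
  exact Matrix.PosSemidef.zero

theorem IsCompletelyPositive.add {n m : Type*} {Φ Ψ : Matrix n n ℂ →ₗ[ℂ] Matrix m m ℂ}
    (hΦ : IsCompletelyPositive Φ) (hΨ : IsCompletelyPositive Ψ) :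
    IsCompletelyPositive (Φ + Ψ) := by
  intro d A hA
  have h : ampliation (Fin d) (Φ + Ψ) A = ampliation (Fin d) Φ A + ampliation (Fin d) Ψ A := by
    ext i j; simp [ampliation]
  rw [h]
  exact (hΦ d A hA).add (hΨ d A hA)

/-- A completely positive map is positive. -/
theorem IsCompletelyPositive.posSemidef {n m : Type*} {Φ : Matrix n n ℂ →ₗ[ℂ] Matrix m m ℂ}
    (hΦ : IsCompletelyPositive Φ) {A : Matrix n n ℂ} (hA : A.PosSemidef) :
    (Φ A).PosSemidef := by
  have h := (hΦ 1 (A.submatrix Prod.snd Prod.snd) (hA.submatrix _)).submatrix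
    (fun i : m => ((0 : Fin 1), i))
  exact h

open scoped MatrixOrder Matrix.Norms.L2Operator in
/-- If both `Φ` and `-Φ` are completely positive then `Φ = 0`. -/
theorem eq_zero_of_isCompletelyPositive_neg {n m : Type*} [Fintype n] [DecidableEq n]
    {Φ : Matrix n n ℂ →ₗ[ℂ] Matrix m m ℂ}
    (h₁ : IsCompletelyPositive Φ) (h₂ : IsCompletelyPositive (-Φ)) : Φ = 0 := by
  have key : Set.EqOn Φ (0 : Matrix n n ℂ →ₗ[ℂ] Matrix m m ℂ) {a | 0 ≤ a} := by
    intro A hA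
    have hA' : A.PosSemidef := Matrix.nonneg_iff_posSemidef.mp hA
    have p₁ : 0 ≤ Φ A := Matrix.nonneg_iff_posSemidef.mpr (h₁.posSemidef hA')
    have p₂ : 0 ≤ -Φ A := Matrix.nonneg_iff_posSemidef.mpr (h₂.posSemidef hA')
    exact le_antisymm (neg_nonneg.mp p₂) p₁
  exact LinearMap.ext_on CStarAlgebra.span_nonneg key

/-! ### Deterministic programs -/

/-- `DProg(V)`: completely positive, trace-nonincreasing super-operators on `ℋ_V`. -/
@[ext]
structure DProg {𝒱 : Type*} [DecidableEq 𝒱] (V : Finset 𝒱) where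
  /-- the underlying super-operator -/
  map : Op V →ₗ[ℂ] Op V
  completelyPositive : IsCompletelyPositive map
  traceNonincreasing : IsTraceNonincreasing map

/-- The approximation (CP) order: `E ⊑ F` iff `F - E` is completely positive. -/
instance {𝒱 : Type*} [DecidableEq 𝒱] (V : Finset 𝒱) : PartialOrder (DProg V) where
  le E F := IsCompletelyPositive (F.map - E.map)
  le_refl E := by
    rw [sub_self]
    exact IsCompletelyPositive.zero
  le_trans E F G h₁ h₂ := by
    rw [← sub_add_sub_cancel G.map F.map E.map]
    exact IsCompletelyPositive.add h₂ h₁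
  le_antisymm E F h₁ h₂ := by
    change IsCompletelyPositive (F.map - E.map) at h₁
    change IsCompletelyPositive (E.map - F.map) at h₂
    rw [← neg_sub] at h₂
    exact DProg.ext (sub_eq_zero.mp (eq_zero_of_isCompletelyPositive_neg h₁ h₂)).symm

/-- The Euclidean topology: since `ℒ(ℋ_V)` is finite-dimensional, it is the topology of pointwise
convergence of super-operators. -/
noncomputable instance {𝒱 : Type*} [DecidableEq 𝒱] (V : Finset 𝒱) : TopologicalSpace (DProg V) :=
  TopologicalSpace.induced (fun E (A : Op V) => E.map A) inferInstance

/-! ### Nondeterministic programs -/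

/-- `NProg(V)`: nonempty, convex and closed sets of deterministic programs. -/
structure NProg {𝒱 : Type*} [DecidableEq 𝒱] (V : Finset 𝒱) where
  /-- the underlying set of deterministic programs -/
  carrier : Set (DProg V)
  nonempty : carrier.Nonempty
  convex : Convex ℝ (DProg.map '' carrier)
  closed : IsClosed carrier

/-! ### Orders on powersets -/

/-- Hoare order. -/
def HoareLE {α : Type*} [PartialOrder α] (X Y : Set α) : Prop := ∀ x ∈ X, ∃ y ∈ Y, x ≤ y

/-- Smyth order. -/
def SmythLE {α : Type*} [PartialOrder α] (X Y : Set α) : Prop := ∀ y ∈ Y, ∃ x ∈ X, x ≤ y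

/-- Egli-Milner order. -/
def EgliMilnerLE {α : Type*} [PartialOrder α] (X Y : Set α) : Prop := HoareLE X Y ∧ SmythLE X Y

/-- The up-closure `↑X`. -/
def upClosure {α : Type*} [PartialOrder α] (X : Set α) : Set α := {y | ∃ x ∈ X, x ≤ y}

/-- The down-closure `↓X`. -/
def downClosure {α : Type*} [PartialOrder α] (X : Set α) : Set α := {y | ∃ x ∈ X, y ≤ x}

/-! ### States, effects and extension to larger systems -/

/-- `𝒟(ℋ_X)`: partial density operators. -/
def IsState {𝒱 : Type*} [DecidableEq 𝒱] {X : Finset 𝒱} (ρ : Op X) : Prop := ρ.PosSemidef ∧ ρ.trace.re ≤ 1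

/-- `𝒫(ℋ_W)`: effects, i.e. operators `M` with `0 ⊑ M ⊑ I` in the Löwner order. -/
def Effect {𝒱 : Type*} [DecidableEq 𝒱] (W : Finset 𝒱) : Type _ :=
  {M : Op W // M.PosSemidef ∧ (1 - M).PosSemidef}

section Extension

variable {𝒱 : Type*} [DecidableEq 𝒱]

/-- For `V ⊆ X`, the identification `ℋ_X = ℋ_{X \ V} ⊗ ℋ_V` on basis vectors. -/
def split {V X : Finset 𝒱} (h : V ⊆ X) : Ket X ≃ Ket (X \ V) × Ket V where
  toFun x := (fun q => x ⟨q, (Finset.mem_sdiff.mp q.2).1⟩, fun q => x ⟨q, h q.2⟩)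
  invFun p := fun q =>
    if hq : (q : 𝒱) ∈ V then p.2 ⟨q, hq⟩ else p.1 ⟨q, Finset.mem_sdiff.mpr ⟨q.2, hq⟩⟩
  left_inv x := by
    funext q
    by_cases hq : (q : 𝒱) ∈ V <;> simp [hq]
  right_inv p := by
    refine Prod.ext (funext fun q => ?_) (funext fun q => ?_)
    · simp [(Finset.mem_sdiff.mp q.2).2]
    · simp

/-- The operator `I_{X \ W} ⊗ M` on `ℋ_X`. -/
def extendOp {W X : Finset 𝒱} (h : W ⊆ X) (M : Op W) : Op X :=
  Matrix.reindex (split h).symm (split h).symm ((1 : Op (X \ W)) ⊗ₖ M)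

/-- The operator `(ℐ_{X \ V} ⊗ Φ)(ρ)` on `ℋ_X`. -/
def extendMap {V X : Finset 𝒱} (h : V ⊆ X) (Φ : Op V →ₗ[ℂ] Op V) (ρ : Op X) : Op X :=
  Matrix.reindex (split h).symm (split h).symm
    (ampliation (Ket (X \ V)) Φ (Matrix.reindex (split h) (split h) ρ))

/-- The set `𝔼(ρ)` of possible outputs of a nondeterministic program on an input `ρ ∈ 𝒟(ℋ_X)`. -/
def NProg.outputs {V X : Finset 𝒱} (E : NProg V) (h : V ⊆ X) (ρ : Op X) : Set (Op X) :=
  (fun D : DProg V => extendMap h D.map ρ) '' E.carrier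

/-! ### Satisfaction, correctness and refinement -/

open Classical in
/-- Demonic satisfaction `Exp_dem(ρ ⊨ Θ) = inf_{M ∈ Θ} tr(Mρ)` for `ρ ∈ 𝒟(ℋ_X)` and `Θ` a set of
effects on `ℋ_W`, `W ⊆ X`; by convention it is `tr ρ` for `Θ = ∅`. -/
noncomputable def expDem {W X : Finset 𝒱} (h : W ⊆ X) (Θ : Set (Effect W)) (ρ : Op X) : ℝ :=
  if Θ.Nonempty then sInf ((fun M : Effect W => (extendOp h M.1 * ρ).trace.re) '' Θ)
  else ρ.trace.re

/-- `𝔼 ⊨_tot (Θ, Ψ)`: total correctness. -/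
def TotalCorrect {V W : Finset 𝒱} (E : NProg V) (Θ Ψ : Set (Effect W)) : Prop :=
  ∀ (X : Finset 𝒱) (hV : V ⊆ X) (hW : W ⊆ X) (ρ : Op X), IsState ρ →
    expDem hW Θ ρ ≤ sInf ((fun σ => expDem hW Ψ σ) '' E.outputs hV ρ)

/-- `𝔼 ⊨_par (Θ, Ψ)`: partial correctness. -/
def PartialCorrect {V W : Finset 𝒱} (E : NProg V) (Θ Ψ : Set (Effect W)) : Prop :=
  ∀ (X : Finset 𝒱) (hV : V ⊆ X) (hW : W ⊆ X) (ρ : Op X), IsState ρ →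
    expDem hW Θ ρ ≤
      sInf ((fun σ => expDem hW Ψ σ + ρ.trace.re - σ.trace.re) '' E.outputs hV ρ)

/-- `𝔼 ≤_T^s 𝔽`: every specification (on any finite set of variables) that `𝔼` satisfies in total
correctness is satisfied by `𝔽`. -/
def RefinesTotal {V : Finset 𝒱} (E F : NProg V) : Prop :=
  ∀ (W : Finset 𝒱) (Θ Ψ : Set (Effect W)), TotalCorrect E Θ Ψ → TotalCorrect F Θ Ψ

/-- `𝔼 ≤_P^s 𝔽`: the same for partial correctness. -/
def RefinesPartial {V : Finset 𝒱} (E F : NProg V) : Prop :=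
  ∀ (W : Finset 𝒱) (Θ Ψ : Set (Effect W)), PartialCorrect E Θ Ψ → PartialCorrect F Θ Ψ

/-- `𝔼 ≡_T^s 𝔽`, the kernel of `≤_T^s`. -/
def EquivTotal {V : Finset 𝒱} (E F : NProg V) : Prop := RefinesTotal E F ∧ RefinesTotal F E

/-- `𝔼 ≡_P^s 𝔽`, the kernel of `≤_P^s`. -/
def EquivPartial {V : Finset 𝒱} (E F : NProg V) : Prop := RefinesPartial E F ∧ RefinesPartial F E

end Extension

end QuantumRefinement

open QuantumRefinement

/-! Order implies refinement because satisfaction is monotone: `Exp(σ ⊨ Ψ)` grows with `σ`, while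
`Exp(σ ⊨ Ψ) - tr σ` decreases, since both `M` and `1 - M` are positive (`expDem_mono`,
`expDem_sub_trace_antitone`).

For the converse, suppose that some `D' ∈ 𝔽` lies above no `D ∈ 𝔼`. Infinitely many variables leave
room to entangle `V` maximally with fresh qubits, and by Choi's criterion the resulting state `ρ`
satisfies: `D(ρ) ⊑ D'(ρ)` forces `D ⊑ D'` (`exists_choi_state`). So the convex set `𝔼(ρ)`, compact
because `DProg V` is compact, misses the closed convex set of operators below `D'(ρ)`. Hahn–Banach
separation (`exists_posSemidef_separating`) yields an effect `H` and a number `c` with `tr(H D'(ρ))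
< c ≤ tr(H D(ρ))` for all `D ∈ 𝔼`. Take `{H}` as postcondition and the set of all weakest
preconditions of `H` under members of `𝔼` as precondition: `𝔼` meets this specification, whereas `𝔽`
violates it at `ρ`. Having sets of effects as preconditions is what makes this work, as the infimum
follows every branch of `𝔼` at once.

Partial correctness is the mirror image: separate the negated sets, and use weakest liberal
preconditions of `1 - H`. The remaining claims are order theory, plus the fact that comparable
trace-preserving maps coincide. -/

namespace QuantumRefinement

open scoped Matrix Kronecker ComplexOrder

/-! ### Positive matrices: trace pairing, closedness, separation. -/

section Matrices

variable {n m k : Type*}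

section
open scoped MatrixOrder Matrix.Norms.L2Operator

theorem exists_eq_conjTranspose_mul_self [Fintype n] [DecidableEq n] {A : Matrix n n ℂ}
    (hA : A.PosSemidef) : ∃ C : Matrix n n ℂ, A = Cᴴ * C := by
  obtain ⟨C, hC⟩ := CStarAlgebra.nonneg_iff_eq_star_mul_self.mp
    (Matrix.nonneg_iff_posSemidef.mpr hA)
  exact ⟨C, hC⟩

theorem exists_smul_le_one [Fintype n] [DecidableEq n] {A : Matrix n n ℂ} (hA : A.PosSemidef) :
    ∃ t : ℝ, 0 < t ∧ (1 - (t : ℂ) • A).PosSemidef := by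
  have h1 := Matrix.le_iff.mp (IsSelfAdjoint.le_algebraMap_norm_self (a := A) hA.1)
  rw [Algebra.algebraMap_eq_smul_one] at h1
  have h0 := norm_nonneg A
  have hp : 0 < ‖A‖ + 1 := by linarith
  -- `A ⊑ ‖A‖ · 1`; the added 1 keeps the scale invertible when `A = 0`.
  refine ⟨(‖A‖ + 1)⁻¹, by positivity, ?_⟩
  have h2 := (h1.add Matrix.PosSemidef.one).smul (a := (((‖A‖ + 1)⁻¹ : ℝ) : ℂ))
    (Complex.zero_le_real.mpr (by positivity))
  have h3 : (((‖A‖ + 1)⁻¹ : ℝ) : ℂ) * ((‖A‖ : ℂ) + 1) = 1 := by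
    rw [← Complex.ofReal_one, ← Complex.ofReal_add, ← Complex.ofReal_mul,
      inv_mul_cancel₀ hp.ne']
  have h4 : 1 - (((‖A‖ + 1)⁻¹ : ℝ) : ℂ) • A =
      (((‖A‖ + 1)⁻¹ : ℝ) : ℂ) • (‖A‖ • (1 : Matrix n n ℂ) - A + 1) := by
    ext i j
    have h4 := congrArg (· * (1 : Matrix n n ℂ) i j) h3
    simp only [Matrix.sub_apply, Matrix.add_apply, Matrix.smul_apply, smul_eq_mul,
      Complex.real_smul] at h4 ⊢
    linear_combination -h4
  rw [h4]
  exact h2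

theorem linearMap_ext_posSemidef [Fintype n] [DecidableEq n] {M : Type*} [AddCommGroup M]
    [Module ℂ M] {f g : Matrix n n ℂ →ₗ[ℂ] M} (h : ∀ A : Matrix n n ℂ, A.PosSemidef → f A = g A) :
    f = g :=
  LinearMap.ext_on CStarAlgebra.span_nonneg fun A hA => h A (Matrix.nonneg_iff_posSemidef.mp hA)

theorem posSemidef_span_induction [Fintype n] [DecidableEq n] {p : Matrix n n ℂ → Prop}
    (hp : ∀ A : Matrix n n ℂ, A.PosSemidef → p A) (hadd : ∀ A B, p A → p B → p (A + B))
    (hsmul : ∀ (c : ℂ) A, p A → p (c • A)) (A : Matrix n n ℂ) : p A := by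
  have hA : A ∈ Submodule.span ℂ {a : Matrix n n ℂ | 0 ≤ a} := by
    rw [CStarAlgebra.span_nonneg]; trivial
  induction hA using Submodule.span_induction with
  | mem x h => exact hp x (Matrix.nonneg_iff_posSemidef.mp h)
  | zero => exact hp 0 Matrix.PosSemidef.zero
  | add x y _ _ hx hy => exact hadd x y hx hy
  | smul c x _ hx => exact hsmul c x hx

end

theorem posSemidef_trace_mul_nonneg [Fintype n] {A B : Matrix n n ℂ} (hA : A.PosSemidef)
    (hB : B.PosSemidef) : 0 ≤ (A * B).trace := by
  classical
  obtain ⟨C, rfl⟩ := exists_eq_conjTranspose_mul_self hB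
  rw [← Matrix.mul_assoc, Matrix.trace_mul_comm, ← Matrix.mul_assoc]
  exact (hA.mul_mul_conjTranspose_same C).trace_nonneg

theorem trace_mul_vecMulVec [Fintype n] (M : Matrix n n ℂ) (x : n → ℂ) :
    (M * Matrix.vecMulVec x (star x)).trace = star x ⬝ᵥ (M *ᵥ x) := by
  rw [Matrix.mul_vecMulVec, Matrix.trace_vecMulVec, dotProduct_comm]

/-- For positive `A`, `tr(Mᴴ A)` is the conjugate of `tr(M A)`. Positive matrices span, so `Mᴴ` and
`M` define the same functional. -/
theorem isHermitian_of_trace_mul_real [Fintype n] {M : Matrix n n ℂ}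
    (h : ∀ A : Matrix n n ℂ, A.PosSemidef → ((M * A).trace).im = 0) : M.IsHermitian := by
  classical
  have h2 : ∀ A : Matrix n n ℂ, A.PosSemidef → (Mᴴ * A).trace = (M * A).trace := by
    intro A hA
    rw [Matrix.trace_mul_comm]
    nth_rewrite 1 [← hA.1.eq]
    rw [← Matrix.conjTranspose_mul, Matrix.trace_conjTranspose]
    exact Complex.conj_eq_iff_im.mpr (h A hA)
  have h3 : (Matrix.traceLinearMap n ℂ ℂ ∘ₗ LinearMap.mulLeft ℂ Mᴴ) =
      (Matrix.traceLinearMap n ℂ ℂ ∘ₗ LinearMap.mulLeft ℂ M) :=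
    linearMap_ext_posSemidef fun A hA => h2 A hA
  ext i j
  have := LinearMap.congr_fun h3 (Matrix.single j i 1)
  simpa [Matrix.trace_mul_single] using this

theorem posSemidef_of_trace_mul_nonneg [Fintype n] {M : Matrix n n ℂ}
    (h : ∀ A : Matrix n n ℂ, A.PosSemidef → 0 ≤ (M * A).trace) : M.PosSemidef := by
  refine .of_dotProduct_mulVec_nonneg (isHermitian_of_trace_mul_real fun A hA => ?_) fun x => ?_
  · exact (Complex.nonneg_iff.mp (h A hA)).2.symm
  · rw [← trace_mul_vecMulVec]
    exact h _ (Matrix.posSemidef_vecMulVec_self_star x)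

/-- Write `A = Cᴴ C` and bound each product `|C a i| |C a j|` by half the sum of the squares. This
is the source of boundedness for `DProg V`. -/
theorem norm_entry_le_trace [Fintype n] {A : Matrix n n ℂ} (hA : A.PosSemidef) (i j : n) :
    ‖A i j‖ ≤ A.trace.re := by
  classical
  obtain ⟨C, rfl⟩ := exists_eq_conjTranspose_mul_self hA
  have ht : ((Cᴴ * C).trace).re = ∑ b, ∑ a, ‖C a b‖ ^ 2 := by
    simp only [Matrix.trace, Matrix.diag_apply, Matrix.mul_apply, Matrix.conjTranspose_apply,
      Complex.re_sum]
    refine Finset.sum_congr rfl fun b _ => Finset.sum_congr rfl fun a _ => ?_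
    rw [← Complex.normSq_eq_norm_sq, Complex.star_def, ← Complex.normSq_eq_conj_mul_self,
      Complex.ofReal_re]
  rw [ht, Finset.sum_comm, Matrix.mul_apply]
  refine (norm_sum_le _ _).trans (Finset.sum_le_sum fun a _ => ?_)
  rw [Matrix.conjTranspose_apply, norm_mul, norm_star]
  have h1 := Finset.single_le_sum (f := fun b => ‖C a b‖ ^ 2) (fun b _ => sq_nonneg _)
    (Finset.mem_univ i)
  have h2 := Finset.single_le_sum (f := fun b => ‖C a b‖ ^ 2) (fun b _ => sq_nonneg _)
    (Finset.mem_univ j)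
  nlinarith [sq_nonneg (‖C a i‖ - ‖C a j‖)]

theorem isClosed_posSemidef [Fintype n] : IsClosed {A : Matrix n n ℂ | A.PosSemidef} := by
  have : {A : Matrix n n ℂ | A.PosSemidef} =
      {A | Aᴴ = A} ∩ ⋂ x : n → ℂ, {A | 0 ≤ star x ⬝ᵥ (A *ᵥ x)} := by
    ext A
    simp [Matrix.posSemidef_iff_dotProduct_mulVec, Matrix.IsHermitian]
  rw [this]
  refine IsClosed.inter (isClosed_eq (by fun_prop) (by fun_prop)) (isClosed_iInter fun x => ?_)
  exact isClosed_le (by fun_prop) (by fun_prop)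

theorem exists_eq_trace_mul [Fintype n] [DecidableEq n] (φ : Matrix n n ℂ →ₗ[ℂ] ℂ) :
    ∃ M : Matrix n n ℂ, ∀ A, φ A = (M * A).trace := by
  refine ⟨Matrix.of fun i j => φ (Matrix.single j i 1), fun A => ?_⟩
  conv_lhs => rw [Matrix.matrix_eq_sum_single A]
  simp only [map_sum, Matrix.trace, Matrix.diag_apply, Matrix.mul_apply, Matrix.of_apply]
  rw [Finset.sum_comm]
  refine Finset.sum_congr rfl fun i _ => Finset.sum_congr rfl fun j _ => ?_
  have : Matrix.single j i (A j i) = A j i • Matrix.single j i (1 : ℂ) := by simp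
  rw [this, map_smul, smul_eq_mul, mul_comm]

/-- Hahn–Banach separates `K` from the set of matrices below `B`. As that set is unbounded in every
negative direction, the functional has a fixed sign on positive matrices; it is thus represented by
a positive matrix, which is rescaled to an effect. -/
theorem exists_posSemidef_separating [Fintype n] [DecidableEq n] {K : Set (Matrix n n ℂ)}
    (hconv : Convex ℝ K) (hcomp : IsCompact K) (hK : ∀ A ∈ K, A.IsHermitian)
    {B : Matrix n n ℂ} (hB : B.IsHermitian) (h : ∀ A ∈ K, ¬ (B - A).PosSemidef) :
    ∃ H : Matrix n n ℂ, H.PosSemidef ∧ (1 - H).PosSemidef ∧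
      ∃ c : ℝ, (H * B).trace.re < c ∧ ∀ A ∈ K, c ≤ (H * A).trace.re := by
  have : LocallyConvexSpace ℝ (Matrix n n ℂ) :=
    inferInstanceAs (LocallyConvexSpace ℝ (n → n → ℂ))
  have hreal : ∀ {P : Matrix n n ℂ} {t : ℝ}, P.PosSemidef → 0 ≤ t → (t • P).PosSemidef := by
    intro P t hP ht
    exact hP.smul ht
  have hTconv : Convex ℝ {C : Matrix n n ℂ | (B - C).PosSemidef} := by
    intro x hx y hy a b ha hb hab
    have hx' : (B - x).PosSemidef := hx
    have hy' : (B - y).PosSemidef := hy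
    have e : B - (a • x + b • y) = a • (B - x) + b • (B - y) := by
      have : B = a • B + b • B := by rw [← add_smul, hab, one_smul]
      nth_rewrite 1 [this]
      module
    change (B - (a • x + b • y)).PosSemidef
    rw [e]
    exact (hreal hx' ha).add (hreal hy' hb)
  have hTclosed : IsClosed {C : Matrix n n ℂ | (B - C).PosSemidef} :=
    isClosed_posSemidef.preimage (f := fun C : Matrix n n ℂ => B - C) (by fun_prop)
  obtain ⟨f, u, v, hu, huv, hv⟩ := RCLike.geometric_hahn_banach_compact_closed (𝕜 := ℂ) hconv hcomp
    hTconv hTclosed (Set.disjoint_left.mpr fun A hA => h A hA)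
  obtain ⟨G, hG⟩ := exists_eq_trace_mul (-(f : Matrix n n ℂ →ₗ[ℂ] ℂ))
  have hG' : ∀ A, (G * A).trace.re = -(f A).re := fun A => by rw [← hG]; simp
  -- Against Hermitian matrices, the real part of the trace pairing sees only the Hermitian part of
  -- `G`.
  set H₀ : Matrix n n ℂ := (1 / 2 : ℂ) • (G + Gᴴ) with hH₀
  have hherm : H₀.IsHermitian := by
    rw [Matrix.IsHermitian, hH₀, Matrix.conjTranspose_smul, Matrix.conjTranspose_add,
      Matrix.conjTranspose_conjTranspose, add_comm]
    simp
  have htr : ∀ A : Matrix n n ℂ, A.IsHermitian → (H₀ * A).trace.re = -(f A).re := by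
    intro A hA
    have h1 : (Gᴴ * A).trace = star ((G * A).trace) := by
      rw [← Matrix.trace_conjTranspose, Matrix.conjTranspose_mul, hA.eq, Matrix.trace_mul_comm]
    rw [hH₀, Matrix.smul_mul, Matrix.add_mul, Matrix.trace_smul, Matrix.trace_add, h1, ← hG' A]
    simp
    ring
  have hcone : ∀ P : Matrix n n ℂ, P.PosSemidef → (f P).re ≤ 0 := by
    intro P hP
    by_contra! hcon
    have h0 := hv B (by simpa using Matrix.PosSemidef.zero)
    -- With this `t` the functional takes the value `v` exactly at `B - t P`, contradicting strict
    -- separation.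
    set t : ℝ := ((f B).re - v) / (f P).re with ht
    have ht0 : 0 ≤ t := div_nonneg (sub_nonneg.mpr h0.le) hcon.le
    have h1 := hv (B - t • P) (by
      change (B - (B - t • P)).PosSemidef
      rw [sub_sub_cancel]
      exact hreal hP ht0)
    have h2 : t * (f P).re = (f B).re - v := by rw [ht, div_mul_cancel₀ _ hcon.ne']
    have h3 : t • P = (t : ℂ) • P := by ext; simp
    rw [h3, map_sub, map_smul] at h1
    simp [h2] at h1
  have hpos : H₀.PosSemidef := by
    refine .of_dotProduct_mulVec_nonneg hherm fun x => ?_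
    have hx := Matrix.posSemidef_vecMulVec_self_star (R := ℂ) x
    rw [Complex.nonneg_iff]
    refine ⟨?_, ?_⟩
    · rw [← trace_mul_vecMulVec, htr _ hx.1]
      linarith [hcone _ hx]
    · have := hherm.im_star_dotProduct_mulVec_self x
      simpa using this.symm
  obtain ⟨t, ht, ht1⟩ := exists_smul_le_one hpos
  have hsc : ∀ A : Matrix n n ℂ, A.IsHermitian →
      (((t : ℂ) • H₀) * A).trace.re = t * (-(f A).re) := by
    intro A hA
    rw [Matrix.smul_mul, Matrix.trace_smul, ← htr A hA]
    simp
  refine ⟨(t : ℂ) • H₀, hpos.smul (Complex.zero_le_real.mpr ht.le), ht1, t * (-u), ?_, ?_⟩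
  · rw [hsc B hB]
    have h0 := hv B (by simpa using Matrix.PosSemidef.zero)
    have h0' : v < (f B).re := h0
    exact mul_lt_mul_of_pos_left (by linarith) ht
  · intro A hA
    rw [hsc A (hK A hA)]
    have h0 : (f A).re < u := hu A hA
    exact mul_le_mul_of_nonneg_left (by linarith) ht.le

/-- The vector `∑ᵢ |i⟩|e i⟩`. -/
def entangledVec [DecidableEq n] (e : k ≃ n) : k × n → ℂ := fun p => if e p.1 = p.2 then 1 else 0

/-- The unnormalised maximally entangled state. -/
def entangled [DecidableEq n] (e : k ≃ n) : Matrix (k × n) (k × n) ℂ :=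
  Matrix.vecMulVec (entangledVec e) (star (entangledVec e))

theorem entangled_posSemidef [Finite k] [Finite n] [DecidableEq n] (e : k ≃ n) :
    (entangled e).PosSemidef :=
  Matrix.posSemidef_vecMulVec_self_star _

/-! ### Ampliations and Choi's criterion. -/

theorem ampliation_submatrix {l : Type*} (Φ : Matrix n n ℂ →ₗ[ℂ] Matrix m m ℂ) (e : l → k)
    (A : Matrix (k × n) (k × n) ℂ) :
    ampliation l Φ (A.submatrix (Prod.map e id) (Prod.map e id)) =
      (ampliation k Φ A).submatrix (Prod.map e id) (Prod.map e id) := rfl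

theorem IsCompletelyPositive.ampliation_posSemidef [Fintype k]
    {Φ : Matrix n n ℂ →ₗ[ℂ] Matrix m m ℂ} (hΦ : IsCompletelyPositive Φ)
    {A : Matrix (k × n) (k × n) ℂ} (hA : A.PosSemidef) : (ampliation k Φ A).PosSemidef := by
  let e := (Fintype.equivFin k).symm
  have h := hΦ _ _ (hA.submatrix (Prod.map e id))
  rw [ampliation_submatrix] at h
  have h2 := h.submatrix (Prod.map e.symm id)
  rw [Matrix.submatrix_submatrix] at h2
  convert h2 using 1
  ext ⟨i, a⟩ ⟨j, b⟩
  simp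

theorem ampliation_entangled_apply [Fintype n] [DecidableEq n] (e : k ≃ n)
    (Φ : Matrix n n ℂ →ₗ[ℂ] Matrix m m ℂ) (i j : k) (a b : m) :
    ampliation k Φ (entangled e) (i, a) (j, b) = Φ (Matrix.single (e i) (e j) 1) a b := by
  have : (Matrix.of fun a b => entangled e (i, a) (j, b)) = Matrix.single (e i) (e j) 1 := by
    ext a b
    simp only [entangled, entangledVec, Matrix.of_apply, Matrix.vecMulVec_apply, Pi.star_apply,
      Matrix.single_apply]
    split_ifs <;> simp_all
  simp only [ampliation, Matrix.of_apply]
  rw [this]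

/-- Choi's criterion. -/
theorem isCompletelyPositive_of_choi [Fintype n] [DecidableEq n] [Fintype m] [Fintype k] (e : k ≃ n)
    {Φ : Matrix n n ℂ →ₗ[ℂ] Matrix m m ℂ} (h : (ampliation k Φ (entangled e)).PosSemidef) :
    IsCompletelyPositive Φ := by
  classical
  intro d A hA
  -- Compressing `A ⊗ Choi(Φ)` by `∑ c, R c` contracts the input index of `A` with the reference
  -- index of the Choi matrix. Expanding the blocks of `A` in matrix units shows that this recovers
  -- `(ℐ ⊗ Φ)(A)`.
  let g : n → Fin d × m → (Fin d × n) × (k × m) := fun c q => ((q.1, c), (e.symm c, q.2))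
  let R : n → Matrix ((Fin d × n) × (k × m)) (Fin d × m) ℂ :=
    fun c => (1 : Matrix _ _ ℂ).submatrix id (g c)
  have hR : ∀ (M : Matrix ((Fin d × n) × (k × m)) ((Fin d × n) × (k × m)) ℂ) (c c' : n),
      (R c)ᴴ * M * R c' = M.submatrix (g c) (g c') := by
    intro M c c'
    ext p q
    simp [R, Matrix.mul_apply, Matrix.one_apply]
  have key := (hA.kronecker h).conjTranspose_mul_mul_same (∑ c, R c)
  have heq : ampliation (Fin d) Φ A =
      (∑ c, R c)ᴴ * (A ⊗ₖ ampliation k Φ (entangled e)) * ∑ c, R c := by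
    rw [Matrix.conjTranspose_sum, Matrix.sum_mul, Matrix.sum_mul]
    simp only [Matrix.mul_sum, hR]
    ext p q
    obtain ⟨i, a⟩ := p
    obtain ⟨j, b⟩ := q
    have h1 : (Matrix.of fun c d => A (i, c) (j, d)) =
        ∑ c, ∑ d, A (i, c) (j, d) • Matrix.single c d (1 : ℂ) := by
      rw [Matrix.matrix_eq_sum_single (Matrix.of fun c d => A (i, c) (j, d))]
      simp
    simp only [Matrix.sum_apply, Matrix.submatrix_apply, Matrix.kroneckerMap_apply, g,
      ampliation_entangled_apply, Equiv.apply_symm_apply]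
    simp only [ampliation, Matrix.of_apply]
    rw [h1]
    simp only [map_sum, map_smul, Matrix.sum_apply, Matrix.smul_apply, smul_eq_mul]
  rw [heq]
  exact key

end Matrices

/-! ### Subsystems and partial traces -/

section Subsystems

variable {𝒱 : Type*} [DecidableEq 𝒱]

theorem trace_reindex {n m : Type*} [Fintype n] [Fintype m] (e : n ≃ m) (A : Matrix n n ℂ) :
    (Matrix.reindex e e A).trace = A.trace := by
  simp only [Matrix.trace, Matrix.diag_apply, Matrix.reindex_apply, Matrix.submatrix_apply]
  exact e.symm.sum_comp fun i => A i i

theorem extendMap_add {V X : Finset 𝒱} (h : V ⊆ X) (Φ Φ' : Op V →ₗ[ℂ] Op V) (ρ : Op X) :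
    extendMap h (Φ + Φ') ρ = extendMap h Φ ρ + extendMap h Φ' ρ := by
  ext; simp [extendMap, ampliation]

theorem extendMap_sub {V X : Finset 𝒱} (h : V ⊆ X) (Φ Φ' : Op V →ₗ[ℂ] Op V) (ρ : Op X) :
    extendMap h (Φ - Φ') ρ = extendMap h Φ ρ - extendMap h Φ' ρ := by
  ext; simp [extendMap, ampliation]

theorem extendMap_real_smul {V X : Finset 𝒱} (h : V ⊆ X) (c : ℝ) (Φ : Op V →ₗ[ℂ] Op V)
    (ρ : Op X) : extendMap h (c • Φ) ρ = c • extendMap h Φ ρ := by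
  ext; simp [extendMap, ampliation]

/-- `extendMap h Φ` as a linear map. -/
def extendLinearMap {V X : Finset 𝒱} (h : V ⊆ X) (Φ : Op V →ₗ[ℂ] Op V) : Op X →ₗ[ℂ] Op X where
  toFun := extendMap h Φ
  map_add' A B := by
    ext i j
    simp only [extendMap, ampliation, Matrix.reindex_apply, Matrix.submatrix_apply,
      Matrix.of_apply, Matrix.add_apply]
    rw [← Matrix.add_apply, ← map_add]
    rfl
  map_smul' c A := by
    ext i j
    simp only [extendMap, ampliation, Matrix.reindex_apply, Matrix.submatrix_apply,
      Matrix.of_apply, Matrix.smul_apply]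
    rw [← Matrix.smul_apply, RingHom.id_apply, ← map_smul]
    rfl

theorem extendMap_posSemidef {V X : Finset 𝒱} (h : V ⊆ X) {Φ : Op V →ₗ[ℂ] Op V}
    (hΦ : IsCompletelyPositive Φ) {ρ : Op X} (hρ : ρ.PosSemidef) :
    (extendMap h Φ ρ).PosSemidef :=
  (hΦ.ampliation_posSemidef (hρ.submatrix _)).submatrix _

/-- The trace is a sum over diagonal blocks, each of them positive, so the bound applies blockwise.
-/
theorem trace_extendMap_le {V X : Finset 𝒱} (h : V ⊆ X) {Φ : Op V →ₗ[ℂ] Op V}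
    (hΦ : IsTraceNonincreasing Φ) {ρ : Op X} (hρ : ρ.PosSemidef) :
    (extendMap h Φ ρ).trace.re ≤ ρ.trace.re := by
  rw [extendMap, trace_reindex, ← trace_reindex (split h) ρ]
  set A := Matrix.reindex (split h) (split h) ρ with hA
  have hApos : A.PosSemidef := hρ.submatrix _
  simp only [Matrix.trace, Matrix.diag_apply, Fintype.sum_prod_type, Complex.re_sum]
  refine Finset.sum_le_sum fun k _ => ?_
  have := hΦ _ (hApos.submatrix fun a => (k, a))
  simp only [Matrix.trace, Matrix.diag_apply, Complex.re_sum] at this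
  exact this

theorem extendOp_posSemidef {W X : Finset 𝒱} (h : W ⊆ X) {M : Op W} (hM : M.PosSemidef) :
    (extendOp h M).PosSemidef :=
  (Matrix.PosSemidef.one.kronecker hM).submatrix _

theorem extendOp_one {W X : Finset 𝒱} (h : W ⊆ X) : extendOp h (1 : Op W) = 1 := by
  simp [extendOp]

theorem extendOp_sub {W X : Finset 𝒱} (h : W ⊆ X) (M N : Op W) :
    extendOp h (M - N) = extendOp h M - extendOp h N := by
  ext; simp [extendOp, mul_sub]

/-- The partial trace over `X \ W`. -/
def partialTrace {W X : Finset 𝒱} (h : W ⊆ X) (ρ : Op X) : Op W :=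
  ∑ k : Ket (X \ W), ρ.submatrix (fun i => (split h).symm (k, i)) (fun i => (split h).symm (k, i))

theorem trace_extendOp_mul {W X : Finset 𝒱} (h : W ⊆ X) (M : Op W) (ρ : Op X) :
    (extendOp h M * ρ).trace = (M * partialTrace h ρ).trace := by
  have h1 : extendOp h M * ρ = Matrix.reindex (split h).symm (split h).symm
      (((1 : Op (X \ W)) ⊗ₖ M) * Matrix.reindex (split h) (split h) ρ) := by
    ext i j
    simp only [extendOp, Matrix.reindex_apply, Equiv.symm_symm, Matrix.submatrix_apply,
      Matrix.mul_apply]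
    rw [← (split h).symm.sum_comp]
    simp
  rw [h1, trace_reindex, partialTrace, Matrix.mul_sum, Matrix.trace_sum]
  simp only [Matrix.trace, Matrix.diag_apply, Matrix.mul_apply, Fintype.sum_prod_type,
    Matrix.kroneckerMap_apply, Matrix.one_apply]
  simp [Finset.sum_ite_eq]

theorem trace_partialTrace {W X : Finset 𝒱} (h : W ⊆ X) (ρ : Op X) :
    (partialTrace h ρ).trace = ρ.trace := by
  have := trace_extendOp_mul h 1 ρ
  rw [extendOp_one, one_mul, one_mul] at this
  exact this.symm

theorem partialTrace_self {X : Finset 𝒱} (h : X ⊆ X) (ρ : Op X) : partialTrace h ρ = ρ := by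
  have hs : ∀ (k : Ket (X \ X)) (i : Ket X), (split h).symm (k, i) = i := by
    intro k i
    funext q
    simp [split]
  have : IsEmpty (X \ X : Finset 𝒱) := by
    rw [Finset.sdiff_self]
    infer_instance
  simp only [partialTrace, hs, Fintype.sum_unique]
  rfl

/-- Discarding qubits outside `X` commutes with a map acting inside `X`. This reduces correctness on
an arbitrary larger system `Y` to an identity on `X`. -/
theorem partialTrace_extendMap {V X Y : Finset 𝒱} (hVX : V ⊆ X) (hXY : X ⊆ Y) (hVY : V ⊆ Y)
    (Φ : Op V →ₗ[ℂ] Op V) (ρ : Op Y) :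
    partialTrace hXY (extendMap hVY Φ ρ) = extendMap hVX Φ (partialTrace hXY ρ) := by
  have h1 : ∀ (k : Ket (Y \ X)) (i : Ket X) (a : Ket V),
      (split hVY).symm ((split hVY ((split hXY).symm (k, i))).1, a) =
        (split hXY).symm (k, (split hVX).symm ((split hVX i).1, a)) := by
    intro k i a
    funext q
    by_cases hq : (q : 𝒱) ∈ V
    · simp [split, hq, hVX hq]
    · by_cases hq' : (q : 𝒱) ∈ X <;> simp [split, hq, hq']
  have h2 : ∀ (k : Ket (Y \ X)) (i : Ket X),
      (split hVY ((split hXY).symm (k, i))).2 = (split hVX i).2 := by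
    intro k i
    funext q
    simp [split, hVX q.2]
  change _ = extendLinearMap hVX Φ (partialTrace hXY ρ)
  rw [partialTrace, partialTrace, map_sum]
  refine Finset.sum_congr rfl fun k _ => ?_
  ext i j
  simp only [extendLinearMap, extendMap, ampliation, Matrix.reindex_apply, Matrix.submatrix_apply,
    Matrix.of_apply, LinearMap.coe_mk, AddHom.coe_mk, Equiv.symm_symm, h1, h2]

theorem trace_extendOp_self {X : Finset 𝒱} (h : X ⊆ X) (M ρ : Op X) :
    (extendOp h M * ρ).trace = (M * ρ).trace := by
  rw [trace_extendOp_mul, partialTrace_self]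

/-! ### Monotonicity of satisfaction -/

/-- A bound uniform over effects passes to the infimum, positivity of `σ` bounding the values below;
`htr` covers the convention for the empty set. Both monotonicity statements are instances. -/
theorem expDem_le_add {W X : Finset 𝒱} (h : W ⊆ X) (Θ : Set (Effect W)) {σ τ : Op X}
    (hσ : σ.PosSemidef) (c : ℝ) (htr : σ.trace.re ≤ τ.trace.re + c)
    (hM : ∀ M : Effect W, (extendOp h M.1 * σ).trace.re ≤ (extendOp h M.1 * τ).trace.re + c) :
    expDem h Θ σ ≤ expDem h Θ τ + c := by
  unfold expDem
  split_ifs with hΘ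
  · rw [← sub_le_iff_le_add]
    refine le_csInf (hΘ.image _) ?_
    rintro _ ⟨M, hMΘ, rfl⟩
    rw [sub_le_iff_le_add]
    refine le_trans (csInf_le ⟨0, ?_⟩ ⟨M, hMΘ, rfl⟩) (hM M)
    rintro _ ⟨N, _, rfl⟩
    exact (Complex.nonneg_iff.mp
      (posSemidef_trace_mul_nonneg (extendOp_posSemidef h N.2.1) hσ)).1
  · exact htr

theorem expDem_mono {W X : Finset 𝒱} (h : W ⊆ X) (Θ : Set (Effect W)) {σ τ : Op X}
    (hσ : σ.PosSemidef) (hστ : (τ - σ).PosSemidef) : expDem h Θ σ ≤ expDem h Θ τ := by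
  have htr := (Complex.nonneg_iff.mp hστ.trace_nonneg).1
  rw [Matrix.trace_sub, Complex.sub_re] at htr
  have := expDem_le_add h Θ (τ := τ) hσ 0 (by linarith) fun M => by
    have := (Complex.nonneg_iff.mp
      (posSemidef_trace_mul_nonneg (extendOp_posSemidef h M.2.1) hστ)).1
    rw [Matrix.mul_sub, Matrix.trace_sub, Complex.sub_re] at this
    linarith
  simpa using this

theorem expDem_sub_trace_antitone {W X : Finset 𝒱} (h : W ⊆ X) (Θ : Set (Effect W)) {σ τ : Op X}
    (hσ : σ.PosSemidef) (hστ : (τ - σ).PosSemidef) :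
    expDem h Θ τ - τ.trace.re ≤ expDem h Θ σ - σ.trace.re := by
  have hτ : τ.PosSemidef := by simpa using hσ.add hστ
  have := expDem_le_add h Θ (τ := σ) hτ (τ.trace.re - σ.trace.re) (by linarith) fun M => by
    have := (Complex.nonneg_iff.mp
      (posSemidef_trace_mul_nonneg (extendOp_posSemidef h M.2.2) hστ)).1
    rw [extendOp_sub, extendOp_one, Matrix.sub_mul, one_mul, Matrix.mul_sub, Matrix.trace_sub,
      Matrix.trace_sub, Matrix.trace_sub, Complex.sub_re, Complex.sub_re, Complex.sub_re] at this
    linarith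
  linarith

theorem expDem_nonneg {W X : Finset 𝒱} (h : W ⊆ X) (Θ : Set (Effect W)) {σ : Op X}
    (hσ : σ.PosSemidef) : 0 ≤ expDem h Θ σ := by
  unfold expDem
  split_ifs with hΘ
  · refine le_csInf (hΘ.image _) ?_
    rintro _ ⟨M, _, rfl⟩
    exact (Complex.nonneg_iff.mp
      (posSemidef_trace_mul_nonneg (extendOp_posSemidef h M.2.1) hσ)).1
  · exact (Complex.nonneg_iff.mp hσ.trace_nonneg).1

theorem expDem_singleton {W X : Finset 𝒱} (h : W ⊆ X) (M : Effect W) (σ : Op X) :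
    expDem h {M} σ = (extendOp h M.1 * σ).trace.re := by
  simp [expDem]

theorem expDem_le_of_mem {W X : Finset 𝒱} (h : W ⊆ X) {Θ : Set (Effect W)} {M : Effect W}
    (hM : M ∈ Θ) {σ : Op X} (hσ : σ.PosSemidef) :
    expDem h Θ σ ≤ (extendOp h M.1 * σ).trace.re := by
  rw [expDem, if_pos ⟨M, hM⟩]
  refine csInf_le ⟨0, ?_⟩ ⟨M, hM, rfl⟩
  rintro _ ⟨N, _, rfl⟩
  exact (Complex.nonneg_iff.mp (posSemidef_trace_mul_nonneg (extendOp_posSemidef h N.2.1) hσ)).1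

theorem le_expDem {W X : Finset 𝒱} (h : W ⊆ X) {Θ : Set (Effect W)} (hΘ : Θ.Nonempty) {σ : Op X}
    {c : ℝ} (hc : ∀ M ∈ Θ, c ≤ (extendOp h M.1 * σ).trace.re) : c ≤ expDem h Θ σ := by
  rw [expDem, if_pos hΘ]
  refine le_csInf (hΘ.image _) ?_
  rintro _ ⟨M, hM, rfl⟩
  exact hc M hM

/-- The real `sInf` is a genuine infimum here, the outputs being nonempty and their values bounded
below by 0. -/
theorem totalCorrect_iff {V W : Finset 𝒱} (E : NProg V) (Θ Ψ : Set (Effect W)) :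
    TotalCorrect E Θ Ψ ↔ ∀ (X : Finset 𝒱) (hV : V ⊆ X) (hW : W ⊆ X) (ρ : Op X), IsState ρ →
      ∀ D ∈ E.carrier, expDem hW Θ ρ ≤ expDem hW Ψ (extendMap hV D.map ρ) := by
  refine forall₄_congr fun X hV hW ρ => forall_congr' fun hρ => ?_
  rw [le_csInf_iff]
  · simp [NProg.outputs]
  · refine ⟨0, ?_⟩
    rintro _ ⟨_, ⟨D, _, rfl⟩, rfl⟩
    exact expDem_nonneg hW Ψ (extendMap_posSemidef hV D.completelyPositive hρ.1)
  · exact (E.nonempty.image _).image _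

theorem partialCorrect_iff {V W : Finset 𝒱} (E : NProg V) (Θ Ψ : Set (Effect W)) :
    PartialCorrect E Θ Ψ ↔ ∀ (X : Finset 𝒱) (hV : V ⊆ X) (hW : W ⊆ X) (ρ : Op X), IsState ρ →
      ∀ D ∈ E.carrier, expDem hW Θ ρ ≤ expDem hW Ψ (extendMap hV D.map ρ) + ρ.trace.re -
        (extendMap hV D.map ρ).trace.re := by
  refine forall₄_congr fun X hV hW ρ => forall_congr' fun hρ => ?_
  rw [le_csInf_iff]
  · simp [NProg.outputs]
  · refine ⟨0, ?_⟩
    rintro _ ⟨_, ⟨D, _, rfl⟩, rfl⟩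
    have h1 := expDem_nonneg hW Ψ (extendMap_posSemidef hV D.completelyPositive hρ.1)
    have h2 := trace_extendMap_le hV D.traceNonincreasing hρ.1
    change 0 ≤ expDem hW Ψ (extendMap hV D.map ρ) + ρ.trace.re - (extendMap hV D.map ρ).trace.re
    linarith
  · exact (E.nonempty.image _).image _

theorem extendMap_mono {V X : Finset 𝒱} (h : V ⊆ X) {D D' : DProg V} (hD : D ≤ D') {ρ : Op X}
    (hρ : ρ.PosSemidef) : (extendMap h D'.map ρ - extendMap h D.map ρ).PosSemidef := by
  rw [← extendMap_sub]
  exact extendMap_posSemidef h hD hρ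

theorem refinesTotal_of_smythLE {V : Finset 𝒱} {E F : NProg V}
    (h : SmythLE E.carrier F.carrier) : RefinesTotal E F := by
  intro W Θ Ψ hE
  rw [totalCorrect_iff] at hE ⊢
  intro X hV hW ρ hρ D' hD'
  obtain ⟨D, hD, hle⟩ := h D' hD'
  exact (hE X hV hW ρ hρ D hD).trans (expDem_mono hW Ψ
    (extendMap_posSemidef hV D.completelyPositive hρ.1) (extendMap_mono hV hle hρ.1))

theorem refinesPartial_of_hoareLE {V : Finset 𝒱} {E F : NProg V}
    (h : HoareLE F.carrier E.carrier) : RefinesPartial E F := by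
  intro W Θ Ψ hE
  rw [partialCorrect_iff] at hE ⊢
  intro X hV hW ρ hρ D' hD'
  obtain ⟨D, hD, hle⟩ := h D' hD'
  have h1 := hE X hV hW ρ hρ D hD
  have h2 := expDem_sub_trace_antitone hW Ψ
    (extendMap_posSemidef hV D'.completelyPositive hρ.1) (extendMap_mono hV hle hρ.1)
  linarith

/-! ### Weakest preconditions -/

theorem exists_effect_of_functional {X : Finset 𝒱} (φ : Op X →ₗ[ℂ] ℂ)
    (h0 : ∀ A : Op X, A.PosSemidef → 0 ≤ φ A) (h1 : ∀ A : Op X, A.PosSemidef → φ A ≤ A.trace) :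
    ∃ M : Effect X, ∀ A, (M.1 * A).trace = φ A := by
  obtain ⟨M, hM⟩ := exists_eq_trace_mul φ
  refine ⟨⟨M, posSemidef_of_trace_mul_nonneg fun A hA => hM A ▸ h0 A hA,
    posSemidef_of_trace_mul_nonneg fun A hA => ?_⟩, fun A => (hM A).symm⟩
  rw [Matrix.sub_mul, one_mul, Matrix.trace_sub, ← hM A]
  exact sub_nonneg.mpr (h1 A hA)

theorem trace_mul_extendMap_nonneg {V X : Finset 𝒱} (h : V ⊆ X) (D : DProg V) (H : Effect X)
    {A : Op X} (hA : A.PosSemidef) : 0 ≤ (H.1 * extendMap h D.map A).trace :=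
  posSemidef_trace_mul_nonneg H.2.1 (extendMap_posSemidef h D.completelyPositive hA)

theorem trace_mul_extendMap_le {V X : Finset 𝒱} (h : V ⊆ X) (D : DProg V) (H : Effect X)
    {A : Op X} (hA : A.PosSemidef) : (H.1 * extendMap h D.map A).trace ≤ A.trace := by
  have h1 := extendMap_posSemidef h D.completelyPositive hA
  have h2 := posSemidef_trace_mul_nonneg H.2.2 h1
  rw [Matrix.sub_mul, one_mul, Matrix.trace_sub, sub_nonneg] at h2
  refine h2.trans (Complex.le_def.mpr ⟨trace_extendMap_le h D.traceNonincreasing hA, ?_⟩)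
  rw [← (Complex.nonneg_iff.mp h1.trace_nonneg).2, ← (Complex.nonneg_iff.mp hA.trace_nonneg).2]

/-- `M` is the Heisenberg dual of the extended `D` applied to `H`. -/
theorem exists_weakestPrecondition {V X : Finset 𝒱} (h : V ⊆ X) (D : DProg V) (H : Effect X) :
    ∃ M : Effect X, ∀ A, (M.1 * A).trace = (H.1 * extendMap h D.map A).trace :=
  exists_effect_of_functional
    (Matrix.traceLinearMap _ ℂ ℂ ∘ₗ LinearMap.mulLeft ℂ H.1 ∘ₗ extendLinearMap h D.map)
    (fun _ hA => trace_mul_extendMap_nonneg h D H hA)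
    (fun _ hA => trace_mul_extendMap_le h D H hA)

/-- `M` is the weakest liberal precondition of `1 - H`, not of `H`: the trace lost by `D` counts as
success. -/
theorem exists_weakestLiberalPrecondition {V X : Finset 𝒱} (h : V ⊆ X) (D : DProg V)
    (H : Effect X) :
    ∃ M : Effect X, ∀ A, (M.1 * A).trace = A.trace - (H.1 * extendMap h D.map A).trace :=
  exists_effect_of_functional
    (Matrix.traceLinearMap _ ℂ ℂ -
      Matrix.traceLinearMap _ ℂ ℂ ∘ₗ LinearMap.mulLeft ℂ H.1 ∘ₗ extendLinearMap h D.map)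
    (fun _ hA => sub_nonneg.mpr (trace_mul_extendMap_le h D H hA))
    (fun _ hA => sub_le_self _ (trace_mul_extendMap_nonneg h D H hA))

/-- Otherwise every weakest precondition of `H` under `𝔼` has value at least `c` at `ρ`, and the
specification formed by these and `{H}` holds for `𝔼` but fails for `D'`. -/
theorem exists_lt_of_refinesTotal {V X : Finset 𝒱} (h : V ⊆ X) {E F : NProg V}
    (hEF : RefinesTotal E F) (H : Effect X) {ρ : Op X} (hρ : IsState ρ) {D' : DProg V}
    (hD' : D' ∈ F.carrier) {c : ℝ} (hc : (H.1 * extendMap h D'.map ρ).trace.re < c) :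
    ∃ D ∈ E.carrier, (H.1 * extendMap h D.map ρ).trace.re < c := by
  by_contra! hcon
  let Θ : Set (Effect X) :=
    {M | ∃ D ∈ E.carrier, ∀ A, (M.1 * A).trace = (H.1 * extendMap h D.map A).trace}
  have hE : TotalCorrect E Θ {H} := by
    rw [totalCorrect_iff]
    intro Y hV hX τ hτ D hD
    obtain ⟨M, hM⟩ := exists_weakestPrecondition h D H
    have hMΘ : M ∈ Θ := ⟨D, hD, hM⟩
    refine (expDem_le_of_mem hX hMΘ hτ.1).trans_eq ?_
    rw [expDem_singleton, trace_extendOp_mul, trace_extendOp_mul, hM,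
      partialTrace_extendMap h hX hV]
  have hF := (totalCorrect_iff _ _ _).mp (hEF X Θ {H} hE) X h subset_rfl ρ hρ D' hD'
  rw [expDem_singleton, trace_extendOp_self] at hF
  refine (hc.trans_le (le_expDem subset_rfl ?_ ?_)).not_ge hF
  · obtain ⟨D, hD⟩ := E.nonempty
    obtain ⟨M, hM⟩ := exists_weakestPrecondition h D H
    exact ⟨M, D, hD, hM⟩
  · rintro M ⟨D, hD, hM⟩
    rw [trace_extendOp_self, hM]
    exact hcon D hD

theorem exists_gt_of_refinesPartial {V X : Finset 𝒱} (h : V ⊆ X) {E F : NProg V}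
    (hEF : RefinesPartial E F) (H : Effect X) {ρ : Op X} (hρ : IsState ρ) {D' : DProg V}
    (hD' : D' ∈ F.carrier) {c : ℝ} (hc : c < (H.1 * extendMap h D'.map ρ).trace.re) :
    ∃ D ∈ E.carrier, c < (H.1 * extendMap h D.map ρ).trace.re := by
  by_contra! hcon
  let Θ : Set (Effect X) :=
    {M | ∃ D ∈ E.carrier, ∀ A, (M.1 * A).trace = A.trace - (H.1 * extendMap h D.map A).trace}
  let N : Effect X := ⟨1 - H.1, H.2.2, by simpa using H.2.1⟩
  have hN : ∀ {Y : Finset 𝒱} (hX : X ⊆ Y) (σ : Op Y),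
      expDem hX {N} σ = σ.trace.re - (H.1 * partialTrace hX σ).trace.re := by
    intro Y hX σ
    rw [expDem_singleton, trace_extendOp_mul, Matrix.sub_mul, one_mul, Matrix.trace_sub,
      trace_partialTrace, Complex.sub_re]
  have hE : PartialCorrect E Θ {N} := by
    rw [partialCorrect_iff]
    intro Y hV hX τ hτ D hD
    obtain ⟨M, hM⟩ := exists_weakestLiberalPrecondition h D H
    have hMΘ : M ∈ Θ := ⟨D, hD, hM⟩
    refine (expDem_le_of_mem hX hMΘ hτ.1).trans_eq ?_
    rw [hN, trace_extendOp_mul, hM, partialTrace_extendMap h hX hV, trace_partialTrace,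
      Complex.sub_re]
    ring
  have hF := (partialCorrect_iff _ _ _).mp (hEF X Θ {N} hE) X h subset_rfl ρ hρ D' hD'
  rw [hN, partialTrace_self] at hF
  have hle : ρ.trace.re - c ≤ expDem subset_rfl Θ ρ := by
    refine le_expDem subset_rfl ?_ ?_
    · obtain ⟨D, hD⟩ := E.nonempty
      obtain ⟨M, hM⟩ := exists_weakestLiberalPrecondition h D H
      exact ⟨M, D, hD, hM⟩
    · rintro M ⟨D, hD, hM⟩
      rw [trace_extendOp_self, hM, Complex.sub_re]
      linarith [hcon D hD]
  linarith

/-- There is a state whose images determine complete positivity. -/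
theorem exists_choi_state [Infinite 𝒱] (V : Finset 𝒱) :
    ∃ (X : Finset 𝒱) (h : V ⊆ X) (ρ : Op X), IsState ρ ∧
      ∀ Φ : Op V →ₗ[ℂ] Op V, (extendMap h Φ ρ).PosSemidef → IsCompletelyPositive Φ := by
  -- As many fresh qubits as `V` has, so that the reference system is a copy of `ℋ_V`.
  obtain ⟨X, h, hX⟩ := Infinite.exists_superset_card_eq V (V.card + V.card) (by omega)
  have hcard : (X \ V).card = V.card := by rw [Finset.card_sdiff_of_subset h]; omega
  let e : Ket (X \ V) ≃ Ket V :=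
    Equiv.arrowCongr (Finset.equivOfCardEq hcard) (Equiv.refl (Fin 2))
  have hpos := entangled_posSemidef e
  have htr := (Complex.nonneg_iff.mp hpos.trace_nonneg).1
  set t : ℝ := ((entangled e).trace.re + 1)⁻¹ with ht
  have ht0 : 0 < t := by positivity
  refine ⟨X, h, Matrix.reindex (split h).symm (split h).symm ((t : ℂ) • entangled e),
    ⟨(hpos.smul (Complex.zero_le_real.mpr ht0.le)).submatrix _, ?_⟩, fun Φ hΦ => ?_⟩
  · rw [trace_reindex, Matrix.trace_smul, smul_eq_mul, Complex.re_ofReal_mul, ht,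
      inv_mul_le_iff₀ (by positivity)]
    linarith
  · refine isCompletelyPositive_of_choi e ?_
    have h1 := hΦ.submatrix (split h).symm
    have h2 := h1.smul (a := ((t⁻¹ : ℝ) : ℂ)) (Complex.zero_le_real.mpr (by positivity))
    have h3 : ampliation (Ket (X \ V)) Φ (entangled e) = ((t⁻¹ : ℝ) : ℂ) •
        (extendMap h Φ (Matrix.reindex (split h).symm (split h).symm
          ((t : ℂ) • entangled e))).submatrix (split h).symm (split h).symm := by
      have htc : (t : ℂ) ≠ 0 := Complex.ofReal_ne_zero.mpr ht0.ne'
      have h4 : Matrix.reindex (split h).symm (split h).symm ((t : ℂ) • entangled e) =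
          (t : ℂ) • Matrix.reindex (split h).symm (split h).symm (entangled e) := rfl
      have h5 := map_smul (extendLinearMap h Φ) (t : ℂ)
        (Matrix.reindex (split h).symm (split h).symm (entangled e))
      change extendMap h Φ _ = (t : ℂ) • extendMap h Φ _ at h5
      rw [h4, h5]
      ext i j
      simp [extendMap, htc]
    rw [h3]
    exact h2

end Subsystems

/-! ### Compactness and the characterization of refinement -/

section Characterization

variable {𝒱 : Type*} [DecidableEq 𝒱]

/-- Linearity, complete positivity and trace nonincrease are all closed conditions under pointwise
convergence. -/
theorem isClosed_range_map (V : Finset 𝒱) :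
    IsClosed (Set.range fun (D : DProg V) (A : Op V) => D.map A) := by
  let amp (d : ℕ) (A : Matrix (Fin d × Ket V) (Fin d × Ket V) ℂ) (f : Op V → Op V) :
      Matrix (Fin d × Ket V) (Fin d × Ket V) ℂ :=
    Matrix.of fun i j => f (Matrix.of fun a b => A (i.1, a) (j.1, b)) i.2 j.2
  have hamp : ∀ d A, Continuous (amp d A) := fun d A => by
    refine continuous_matrix fun i j => ?_
    simp only [amp, Matrix.of_apply]
    fun_prop
  have : (Set.range fun (D : DProg V) (A : Op V) => D.map A) =
      Set.range ((↑) : (Op V →ₗ[ℂ] Op V) → Op V → Op V) ∩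
      ((⋂ d, ⋂ A : {A : Matrix (Fin d × Ket V) (Fin d × Ket V) ℂ // A.PosSemidef},
        amp d A ⁻¹' {B | B.PosSemidef}) ∩
      ⋂ A : {A : Op V // A.PosSemidef}, {f | (f A).trace.re ≤ A.1.trace.re}) := by
    ext f
    constructor
    · rintro ⟨D, rfl⟩
      refine ⟨⟨D.map, rfl⟩, Set.mem_iInter₂.mpr fun d A => ?_, Set.mem_iInter.mpr fun A => ?_⟩
      · exact D.completelyPositive d A.1 A.2
      · exact D.traceNonincreasing A.1 A.2
    · rintro ⟨⟨Φ, rfl⟩, h1, h2⟩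
      rw [Set.mem_iInter₂] at h1
      rw [Set.mem_iInter] at h2
      exact ⟨⟨Φ, fun d A hA => h1 d ⟨A, hA⟩, fun A hA => h2 ⟨A, hA⟩⟩, rfl⟩
  rw [this]
  refine (LinearMap.isClosed_range_coe _ _ _).inter (IsClosed.inter ?_ ?_)
  · exact isClosed_iInter fun d => isClosed_iInter fun A =>
      isClosed_posSemidef.preimage (hamp d A)
  · refine isClosed_iInter fun A => isClosed_le ?_ continuous_const
    exact Complex.continuous_re.comp ((continuous_apply A.1).matrix_trace)

/-- On positive `A` the entries of `D(A)` are at most `tr D(A) ≤ tr A`; the bound extends to the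
linear span. -/
theorem exists_bound_map (V : Finset 𝒱) (A : Op V) :
    ∃ r : ℝ, ∀ (D : DProg V) i j, ‖D.map A i j‖ ≤ r := by
  induction A using posSemidef_span_induction with
  | hp A hA =>
    exact ⟨A.trace.re, fun D i j => (norm_entry_le_trace
      (D.completelyPositive.posSemidef hA) i j).trans (D.traceNonincreasing A hA)⟩
  | hadd A B hA hB =>
    obtain ⟨r, hr⟩ := hA
    obtain ⟨s, hs⟩ := hB
    refine ⟨r + s, fun D i j => ?_⟩
    rw [map_add, Matrix.add_apply]
    exact (norm_add_le _ _).trans (add_le_add (hr D i j) (hs D i j))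
  | hsmul c A hA =>
    obtain ⟨r, hr⟩ := hA
    refine ⟨‖c‖ * r, fun D i j => ?_⟩
    rw [map_smul, Matrix.smul_apply, norm_smul]
    exact mul_le_mul_of_nonneg_left (hr D i j) (norm_nonneg c)

theorem isInducing_map (V : Finset 𝒱) :
    Topology.IsInducing fun (D : DProg V) (A : Op V) => D.map A := ⟨rfl⟩

/-- Tychonoff: the programs form a closed subset of a product of closed balls, indexed by operators
and matrix entries. -/
instance (V : Finset 𝒱) : CompactSpace (DProg V) := by
  rw [← isCompact_univ_iff, (isInducing_map V).isCompact_iff, Set.image_univ]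
  choose r hr using exists_bound_map V
  have hK : IsCompact (Set.univ.pi fun A : Op V => Set.univ.pi fun _ : Ket V =>
      Set.univ.pi fun _ : Ket V => Metric.closedBall (0 : ℂ) (r A)) :=
    isCompact_univ_pi fun A => isCompact_univ_pi fun _ => isCompact_univ_pi fun _ =>
      isCompact_closedBall _ _
  refine hK.of_isClosed_subset (isClosed_range_map V) ?_
  rintro _ ⟨D, rfl⟩ A _ i _ j _
  exact mem_closedBall_zero_iff.mpr (hr A D i j)

theorem continuous_extendMap {V X : Finset 𝒱} (h : V ⊆ X) (ρ : Op X) :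
    Continuous fun D : DProg V => extendMap h D.map ρ := by
  refine continuous_matrix fun i j => ?_
  simp only [extendMap, ampliation, Matrix.reindex_apply, Matrix.submatrix_apply, Matrix.of_apply]
  exact (((continuous_apply _).comp (isInducing_map V).continuous).matrix_elem _ _)

theorem NProg.isCompact_outputs {V X : Finset 𝒱} (E : NProg V) (h : V ⊆ X) (ρ : Op X) :
    IsCompact (E.outputs h ρ) :=
  E.closed.isCompact.image (continuous_extendMap h ρ)

theorem NProg.convex_outputs {V X : Finset 𝒱} (E : NProg V) (h : V ⊆ X) (ρ : Op X) :
    Convex ℝ (E.outputs h ρ) := by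
  have hlin : IsLinearMap ℝ fun Φ : Op V →ₗ[ℂ] Op V => extendMap h Φ ρ :=
    ⟨fun _ _ => extendMap_add h _ _ ρ, fun c _ => extendMap_real_smul h c _ ρ⟩
  have := E.convex.is_linear_image hlin
  rwa [Set.image_image] at this

theorem NProg.isHermitian_of_mem_outputs {V X : Finset 𝒱} (E : NProg V) (h : V ⊆ X) {ρ : Op X}
    (hρ : IsState ρ) : ∀ σ ∈ E.outputs h ρ, σ.IsHermitian := by
  rintro _ ⟨D, _, rfl⟩
  exact (extendMap_posSemidef h D.completelyPositive hρ.1).1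

theorem refinesTotal_iff_smythLE [Infinite 𝒱] {V : Finset 𝒱} {E F : NProg V} :
    RefinesTotal E F ↔ SmythLE E.carrier F.carrier := by
  refine ⟨fun hEF D' hD' => ?_, refinesTotal_of_smythLE⟩
  obtain ⟨X, h, ρ, hρ, hchoi⟩ := exists_choi_state V
  by_contra! hcon
  obtain ⟨H, h0, h1, c, hc, hK⟩ := exists_posSemidef_separating (E.convex_outputs h ρ)
    (E.isCompact_outputs h ρ) (E.isHermitian_of_mem_outputs h hρ)
    (extendMap_posSemidef h D'.completelyPositive hρ.1).1 (by
      rintro _ ⟨D, hD, rfl⟩ hpos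
      refine hcon D hD (hchoi _ ?_)
      rw [extendMap_sub]
      exact hpos)
  obtain ⟨D, hD, hlt⟩ := exists_lt_of_refinesTotal h hEF ⟨H, h0, h1⟩ hρ hD' hc
  exact (hK _ ⟨D, hD, rfl⟩).not_gt hlt

theorem refinesPartial_iff_hoareLE [Infinite 𝒱] {V : Finset 𝒱} {E F : NProg V} :
    RefinesPartial E F ↔ HoareLE F.carrier E.carrier := by
  refine ⟨fun hEF D' hD' => ?_, refinesPartial_of_hoareLE⟩
  obtain ⟨X, h, ρ, hρ, hchoi⟩ := exists_choi_state V
  by_contra! hcon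
  -- Negation turns "above `D'(ρ)`" into "below `-D'(ρ)`", so the same separation lemma applies.
  obtain ⟨H, h0, h1, c, hc, hK⟩ := exists_posSemidef_separating (E.convex_outputs h ρ).neg
    (E.isCompact_outputs h ρ).neg
    (fun A hA => by simpa using (E.isHermitian_of_mem_outputs h hρ (-A) hA).neg)
    (extendMap_posSemidef h D'.completelyPositive hρ.1).1.neg (by
      rintro A ⟨D, hD, hA⟩ hpos
      refine hcon D hD (hchoi _ ?_)
      rw [extendMap_sub]
      have hA' : A = -extendMap h D.map ρ := neg_eq_iff_eq_neg.mp hA.symm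
      rw [hA'] at hpos
      convert hpos using 1
      abel)
  obtain ⟨D, hD, hlt⟩ := exists_gt_of_refinesPartial h hEF ⟨H, h0, h1⟩ hρ hD' (c := -c) (by
    rw [Matrix.mul_neg, Matrix.trace_neg, Complex.neg_re] at hc
    linarith)
  have := hK (-extendMap h D.map ρ) (by rw [Set.neg_mem_neg]; exact ⟨D, hD, rfl⟩)
  rw [Matrix.mul_neg, Matrix.trace_neg, Complex.neg_re] at this
  change -c < (H * extendMap h D.map ρ).trace.re at hlt
  linarith

/-! ### Closures, and the trace-preserving case. -/

theorem smythLE_iff_upClosure {α : Type*} [PartialOrder α] {X Y : Set α} :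
    SmythLE X Y ↔ upClosure Y ⊆ upClosure X := by
  refine ⟨?_, fun h y hy => h ⟨y, hy, le_rfl⟩⟩
  rintro h z ⟨y, hy, hyz⟩
  obtain ⟨x, hx, hxy⟩ := h y hy
  exact ⟨x, hx, hxy.trans hyz⟩

theorem hoareLE_iff_downClosure {α : Type*} [PartialOrder α] {X Y : Set α} :
    HoareLE X Y ↔ downClosure X ⊆ downClosure Y := by
  refine ⟨?_, fun h x hx => h ⟨x, hx, le_rfl⟩⟩
  rintro h z ⟨x, hx, hzx⟩
  obtain ⟨y, hy, hxy⟩ := h x hx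
  exact ⟨y, hy, hzx.trans hxy⟩

/-- On positive inputs the difference is positive with trace zero, hence zero. -/
theorem DProg.eq_of_le_of_tracePreserving {V : Finset 𝒱} {D D' : DProg V} (h : D ≤ D')
    (hD : IsTracePreserving D.map) (hD' : IsTracePreserving D'.map) : D = D' := by
  refine DProg.ext (linearMap_ext_posSemidef fun A hA => ?_)
  have h1 : (D'.map A - D.map A).PosSemidef := IsCompletelyPositive.posSemidef h hA
  have h2 := h1.trace_eq_zero_iff.mp (by rw [Matrix.trace_sub, hD A hA, hD' A hA, sub_self])
  exact (sub_eq_zero.mp h2).symm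

theorem smythLE_iff_subset {V : Finset 𝒱} {S T : Set (DProg V)}
    (hS : ∀ D ∈ S, IsTracePreserving D.map) (hT : ∀ D ∈ T, IsTracePreserving D.map) :
    SmythLE S T ↔ T ⊆ S := by
  refine ⟨fun h D hD => ?_, fun h D hD => ⟨D, h hD, le_rfl⟩⟩
  obtain ⟨D', hD', hle⟩ := h D hD
  rwa [← DProg.eq_of_le_of_tracePreserving hle (hS D' hD') (hT D hD)]

theorem hoareLE_iff_subset {V : Finset 𝒱} {S T : Set (DProg V)}
    (hS : ∀ D ∈ S, IsTracePreserving D.map) (hT : ∀ D ∈ T, IsTracePreserving D.map) :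
    HoareLE T S ↔ T ⊆ S := by
  refine ⟨fun h D hD => ?_, fun h D hD => ⟨D, h hD, le_rfl⟩⟩
  obtain ⟨D', hD', hle⟩ := h D hD
  rwa [DProg.eq_of_le_of_tracePreserving hle (hT D hD) (hS D' hD')]

end Characterization

end QuantumRefinement

theorem mainTheorem1 {𝒱 : Type*} [DecidableEq 𝒱] [Countable 𝒱] [Infinite 𝒱]
    (V : Finset 𝒱) (E F : NProg V) :
    -- (1) total correctness and the Smyth order
    ((RefinesTotal E F ↔ SmythLE E.carrier F.carrier) ∧
      (SmythLE E.carrier F.carrier ↔ upClosure F.carrier ⊆ upClosure E.carrier)) ∧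
    -- (2) partial correctness and the Hoare order
    ((RefinesPartial E F ↔ HoareLE F.carrier E.carrier) ∧
      (HoareLE F.carrier E.carrier ↔ downClosure F.carrier ⊆ downClosure E.carrier)) ∧
    -- (3) the Egli-Milner order
    (EgliMilnerLE E.carrier F.carrier ↔ RefinesTotal E F ∧ RefinesPartial F E) ∧
    -- (4) the induced equivalences
    ((EquivTotal E F ↔ upClosure E.carrier = upClosure F.carrier) ∧
      (EquivPartial E F ↔ downClosure E.carrier = downClosure F.carrier)) ∧
    -- (5) the trace-preserving case
    ((∀ D ∈ E.carrier, IsTracePreserving D.map) → (∀ D ∈ F.carrier, IsTracePreserving D.map) →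
      (RefinesTotal E F ↔ RefinesPartial E F) ∧
      (RefinesPartial E F ↔ F.carrier ⊆ E.carrier)) := by
  refine ⟨⟨refinesTotal_iff_smythLE, smythLE_iff_upClosure⟩,
    ⟨refinesPartial_iff_hoareLE, hoareLE_iff_downClosure⟩, ?_, ⟨?_, ?_⟩, fun hE hF => ⟨?_, ?_⟩⟩
  · rw [EgliMilnerLE, refinesTotal_iff_smythLE, refinesPartial_iff_hoareLE, and_comm]
  · rw [EquivTotal, refinesTotal_iff_smythLE, refinesTotal_iff_smythLE, smythLE_iff_upClosure,
      smythLE_iff_upClosure, and_comm, Set.Subset.antisymm_iff]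
  · rw [EquivPartial, refinesPartial_iff_hoareLE, refinesPartial_iff_hoareLE,
      hoareLE_iff_downClosure, hoareLE_iff_downClosure, and_comm, Set.Subset.antisymm_iff]
  · rw [refinesTotal_iff_smythLE, refinesPartial_iff_hoareLE, smythLE_iff_subset hE hF,
      hoareLE_iff_subset hE hF]
  · rw [refinesPartial_iff_hoareLE, hoareLE_iff_subset hE hF]
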